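/- Let $k\ge 0$ be an integer. For vectors $\mathbf I,\mathbf J\in\mathbb R^k$ put $|\mathbf I|=\sum_{i=1}^k I_i$ and $\varphi(\mathbf I,\mathbf J)=\sum_{1\le i<j\le k}I_iJ_j$, and let $(z;t)_n=\prod_{m=0}^{n-1}(1-zt^m)$. For $\mathbf I,\mathbf J,\mathbf K,\mathbf L\in\{0,1\}^k$ define the purple vertex weight $$L'_x(\mathbf I,\mathbf J,\mathbf K,\mathbf L)=\mathbf 1_{\mathbf I+\mathbf J=\mathbf K+\mathbf L}\ \prod_{i=1}^k\mathbf 1_{K_i\ge J_i}\cdot x^{|\mathbf L|}\,t^{\varphi(\mathbf L,\mathbf K-\mathbf J)}$$ (a box with bottom, left, top, right edges labelled $\mathbf I,\mathbf J,\mathbf K,\mathbf L$) and the cross weight $$R''_{x/y}(\mathbf I,\mathbf J,\mathbf K,\mathbf L)=\mathbf 1_{\mathbf I+\mathbf J=\mathbf K+\mathbf L}\ \prod_{i=1}^k\mathbf 1_{K_i\ge J_i}\cdot (x/y)^{|\mathbf L|}\,(x/y;t)_{|\mathbf K|-|\mathbf J|}\,t^{\varphi(\mathbf L,\mathbf K-\mathbf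 J)}$$ (a cross with bottom-left, top-left, top-right, bottom-right edges labelled $\mathbf I,\mathbf J,\mathbf K,\mathbf L$). Here $x,y,t$ are elements of an arbitrary field with $y\ne 0$; in particular they may be the indeterminates of $\mathbb C(x,y,t)$. (1) (Yang–Baxter equation.) For all boundary labels $\mathbf I_1,\mathbf J_1,\mathbf K_1,\mathbf I_3,\mathbf J_3,\mathbf K_3\in\{0,1\}^k$, $$\sum_{\mathbf I_2,\mathbf J_2,\mathbf K_2}R''_{x/y}(\mathbf I_1,\mathbf J_1,\mathbf I_2,\mathbf J_2)\,L'_x(\mathbf K_1,\mathbf J_2,\mathbf K_2,\mathbf J_3)\,L'_y(\mathbf K_2,\mathbf I_2,\mathbf K_3,\mathbf I_3) =\sum_{\mathbf I_2,\mathbf J_2,\mathbf K_2}L'_y(\mathbf K_1,\mathbf I_1,\mathbf K_2,\mathbf I_2)\,L'_x(\mathbf K_2,\mathbf J_1,\mathbf K_3,\mathbf J_2)\,R''_{x/y}(\mathbf I_2,\mathbf J_2,\mathbf I_3,\mathbf J_3),$$ where the sums run over $\mathbf I_2,\mathbf J_2,\mathbf K_2\in\{0,1\}^k$. (2) (Swapping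 two purple rows.) For every $N\ge 0$ and all $\boldsymbol\beta,\boldsymbol\tau\in(\{0,1\}^k)^N$, let $Z_{x_1,x_2}(\boldsymbol\beta,\boldsymbol\tau)$ be the partition function (the sum over all labellings of the interior edges of the product of the vertex weights) of the lattice formed by two stacked rows of $N$ purple boxes, the bottom row with weights $L'_{x_1}$ and the top row with weights $L'_{x_2}$, whose bottom edges are labelled by $\boldsymbol\beta$, whose top edges are labelled by $\boldsymbol\tau$, and whose left and right boundary edges all carry the label $\mathbf 0$. Then $Z_{x,y}(\boldsymbol\beta,\boldsymbol\tau)=Z_{y,x}(\boldsymbol\beta,\boldsymbol\tau)$. -/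

import Mathlib

open Finset

namespace PurpleVertex

/-- An edge label: a vector in `{0,1}^k`, the `i`-th entry being `1` exactly when a path of
colour `i` runs through the edge. Entries are compared and added as natural numbers. -/
abbrev Label (k : ℕ) : Type := Fin k → Fin 2

/-- `|I| = ∑ i, I_i`. -/
def weight {k : ℕ} (I : Fin k → ℕ) : ℕ := ∑ i, I i

/-- `φ(I, J) = ∑_{i < j} I_i J_j`. -/
def phi {k : ℕ} (I J : Fin k → ℕ) : ℕ :=
  ∑ i, ∑ j, if i < j then I i * J j else 0

/-- The `t`-Pochhammer symbol `(x; t)_n = ∏_{m = 0}^{n - 1} (1 - x t^m)`. -/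
def pochhammer {R : Type*} [CommRing R] (x t : R) (n : ℕ) : R :=
  ∏ m ∈ range n, (1 - x * t ^ m)

/-- The label as a vector of natural numbers. -/
def Label.nat {k : ℕ} (I : Label k) : Fin k → ℕ := fun i => (I i : ℕ)

/-- The vertex restrictions shared by `L'` and `R''`: path conservation `I + J = K + L`
(as integer vectors) together with `K_i ≥ J_i` for every colour `i`. -/
def Allowed {k : ℕ} (I J K L : Label k) : Prop :=
  (∀ i, I.nat i + J.nat i = K.nat i + L.nat i) ∧ (∀ i, J.nat i ≤ K.nat i)

instance {k : ℕ} (I J K L : Label k) : Decidable (Allowed I J K L) := by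
  unfold Allowed; infer_instance

/-- The purple vertex `L'_x(I, J, K, L)`: a box with bottom edge `I`, left edge `J`, top edge `K`
and right edge `L`. The subtraction `K - J` is only used where `J ≤ K` entrywise. -/
def purpleL {R : Type*} [CommRing R] {k : ℕ} (x t : R) (I J K L : Label k) : R :=
  if Allowed I J K L then
    x ^ weight L.nat * t ^ phi L.nat (fun i => K.nat i - J.nat i)
  else 0

/-- The cross `R''_z(I, J, K, L)`, used at `z = x / y`: a cross with edge `I` at the bottom left,
`J` at the top left, `K` at the top right and `L` at the bottom right. Both subtractions are only
used where `J ≤ K` entrywise. -/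
def crossR {R : Type*} [CommRing R] {k : ℕ} (z t : R) (I J K L : Label k) : R :=
  if Allowed I J K L then
    z ^ weight L.nat * pochhammer z t (weight K.nat - weight J.nat) *
      t ^ phi L.nat (fun i => K.nat i - J.nat i)
  else 0

/-- Partition function of a single purple row of `N` boxes with parameter `x`: the sum, over all
labels `h 0, …, h N` of the horizontal edges with prescribed leftmost and rightmost label, of the
product of the vertex weights. -/
def purpleRow {R : Type*} [CommRing R] {k N : ℕ} (x t : R) (left right : Label k)
    (bottom top : Fin N → Label k) : R :=
  ∑ h : Fin (N + 1) → Label k,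
    if h 0 = left ∧ h (Fin.last N) = right then
      ∏ c : Fin N, purpleL x t (bottom c) (h c.castSucc) (top c) (h c.succ)
    else 0

/-- Partition function of two stacked purple rows of `N` boxes, the bottom row with parameter `x₁`
and the top row with parameter `x₂`, with empty left and right boundaries. -/
def twoPurpleRows {R : Type*} [CommRing R] {k N : ℕ} (x₁ x₂ t : R)
    (bottom top : Fin N → Label k) : R :=
  ∑ mid : Fin N → Label k,
    purpleRow x₁ t (fun _ => 0) (fun _ => 0) bottom mid *
      purpleRow x₂ t (fun _ => 0) (fun _ => 0) mid top

end PurpleVertex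

namespace PurpleVertex

/-! Path conservation pulls the same factor y^(|I₃|+|J₃|) (x/y)^|J₃| out of both sides of the
Yang–Baxter equation, leaving `leftSum` and `rightSum` in z = x/y and t. These are compared by
induction on k, removing the first colour. It sees the other colours only through total weights, of
which |J₂| alone is not fixed by the boundary data. Let e_z be z^|J₂| times the Pochhammer symbol of
z. Since (1 - z t^d)(z;t)_d = (1 - z)(zt;t)_d, the first colour turns e_z into A e_z + B e_{zt},
with the same A and B on both sides (`exists_head_eq`). The induction hypothesis at z and at zt then
closes the step.

For the swap, the equation says that the cross intertwines the column transfer matrices, hence those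
of whole rows. At the empty boundary the cross is trivial. -/

/-- The exponent of `t` shared by `L'` and `R''`. -/
def crossings {k : ℕ} (J K L : Label k) : ℕ := phi L.nat (fun i => K.nat i - J.nat i)

/-- `Allowed` for a single colour. -/
def AllowedBit (i j k l : Fin 2) : Prop := (i : ℕ) + j = k + l ∧ (j : ℕ) ≤ k

instance (i j k l : Fin 2) : Decidable (AllowedBit i j k l) := by
  unfold AllowedBit; infer_instance

/-- Prepend a colour to a label. -/
def consLabel {k : ℕ} (a : Fin 2) (I : Label k) : Label (k + 1) := Fin.cons a I

theorem exists_consLabel {k : ℕ} (I : Label (k + 1)) : ∃ a I', I = consLabel a I' :=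
  ⟨I 0, Fin.tail I, (Fin.cons_self_tail I).symm⟩

theorem sum_consLabel {M : Type*} [AddCommMonoid M] {k : ℕ} (f : Label (k + 1) → M) :
    ∑ I, f I = ∑ a, ∑ I, f (consLabel a I) := by
  rw [← Fintype.sum_prod_type', ← (Fin.consEquiv (fun _ => Fin 2)).sum_comp]
  rfl

/-- The bits are summed innermost, so that the first colour's contribution becomes an inner sum. -/
theorem sum_consLabel₃ {M : Type*} [AddCommMonoid M] {k : ℕ}
    (f : Label (k + 1) → Label (k + 1) → Label (k + 1) → M) :
    ∑ I, ∑ J, ∑ K, f I J K = ∑ I, ∑ J, ∑ K, ∑ a, ∑ b, ∑ c,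
      f (consLabel a I) (consLabel b J) (consLabel c K) := by
  simp only [sum_consLabel, Fin.sum_univ_two, sum_add_distrib]

@[simp] theorem weight_consLabel {k : ℕ} (a : Fin 2) (I : Label k) :
    weight (consLabel a I).nat = a + weight I.nat := by
  simp [weight, Fin.sum_univ_succ, Label.nat, consLabel]

/-- The new colour precedes all others, so it enters φ only as the smaller index and its bits in K
and J drop out. -/
theorem crossings_consLabel {k : ℕ} (j c l : Fin 2) (J K L : Label k) :
    crossings (consLabel j J) (consLabel c K) (consLabel l L) =
      l * weight (fun i => K.nat i - J.nat i) + crossings J K L := by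
  simp [crossings, phi, weight, Fin.sum_univ_succ, Label.nat, consLabel, mul_sum]

theorem allowed_consLabel {k : ℕ} (i j c l : Fin 2) (I J K L : Label k) :
    Allowed (consLabel i I) (consLabel j J) (consLabel c K) (consLabel l L) ↔
      AllowedBit i j c l ∧ Allowed I J K L := by
  simp only [Allowed, AllowedBit, Fin.forall_fin_succ, Label.nat, consLabel, Fin.cons_zero,
    Fin.cons_succ]
  tauto

theorem Allowed.weight_add {k : ℕ} {I J K L : Label k} (h : Allowed I J K L) :
    weight I.nat + weight J.nat = weight K.nat + weight L.nat := by
  simp only [weight, ← sum_add_distrib]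
  exact sum_congr rfl fun i _ => h.1 i

theorem Allowed.weight_sub {k : ℕ} {I J K L : Label k} (h : Allowed I J K L) :
    weight (fun i => K.nat i - J.nat i) + weight J.nat = weight K.nat := by
  simp only [weight, ← sum_add_distrib]
  exact sum_congr rfl fun i _ => Nat.sub_add_cancel (h.2 i)

/-! ### Splitting off the first colour -/

section Sums
variable {R : Type*} [CommRing R] {k : ℕ}

/-- The left-hand side of the Yang–Baxter equation with the row parameters factored out. -/
def leftSum (z t : R) (I₁ J₁ K₁ I₃ J₃ K₃ : Label k) : R :=
  ∑ I₂ : Label k, ∑ J₂ : Label k, ∑ K₂ : Label k,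
    if Allowed I₁ J₁ I₂ J₂ ∧ Allowed K₁ J₂ K₂ J₃ ∧ Allowed K₂ I₂ K₃ I₃ then
      t ^ (crossings J₁ I₂ J₂ + crossings J₂ K₂ J₃ + crossings I₂ K₃ I₃) *
        (z ^ weight J₂.nat * pochhammer z t (weight I₁.nat - weight J₂.nat))
    else 0

/-- The right-hand side of the Yang–Baxter equation with the row parameters factored out. -/
def rightSum (z t : R) (I₁ J₁ K₁ I₃ J₃ K₃ : Label k) : R :=
  ∑ I₂ : Label k, ∑ J₂ : Label k, ∑ K₂ : Label k,
    if Allowed K₁ I₁ K₂ I₂ ∧ Allowed K₂ J₁ K₃ J₂ ∧ Allowed I₂ J₂ I₃ J₃ then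
      t ^ (crossings I₁ K₂ I₂ + crossings J₁ K₃ J₂ + crossings J₂ I₃ J₃) *
        (z ^ weight J₂.nat * pochhammer z t (weight I₃.nat - weight J₂.nat))
    else 0

/-- The contribution of the first colour to `leftSum`, multiplied by `t ^ r`. -/
def leftHead (z t : R) (i₁ j₁ k₁ i₃ j₃ k₃ : Fin 2) (n q s r : ℕ) : R :=
  ∑ i₂ : Fin 2, ∑ j₂ : Fin 2, ∑ k₂ : Fin 2,
    if AllowedBit i₁ j₁ i₂ j₂ ∧ AllowedBit k₁ j₂ k₂ j₃ ∧ AllowedBit k₂ i₂ k₃ i₃ then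
      -- Here n = |I₁|, q = |K₁| - |J₃|, s = |J₂|, r = |I₃|. The three cofactors are the values of
      -- |K - J| at the three vertices.
      t ^ (r + (j₂ * (n - s) + j₃ * q + i₃ * (s + q - r))) *
        (z ^ (j₂ + s) * pochhammer z t (i₁ + n - (j₂ + s)))
    else 0

/-- The contribution of the first colour to `rightSum`, multiplied by `t ^ r`. -/
def rightHead (z t : R) (i₁ j₁ k₁ i₃ j₃ k₃ : Fin 2) (n q s r : ℕ) : R :=
  ∑ i₂ : Fin 2, ∑ j₂ : Fin 2, ∑ k₂ : Fin 2,
    if AllowedBit k₁ i₁ k₂ i₂ ∧ AllowedBit k₂ j₁ k₃ j₂ ∧ AllowedBit i₂ j₂ i₃ j₃ then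
      t ^ (r + (i₂ * (s + q - r) + j₂ * (n + q - r) + j₃ * (r - s))) *
        (z ^ (j₂ + s) * pochhammer z t (i₃ + r - (j₂ + s)))
    else 0

theorem pochhammer_succ (z t : R) (n : ℕ) :
    pochhammer z t (n + 1) = pochhammer z t n * (1 - z * t ^ n) := by
  simp [pochhammer, prod_range_succ]

theorem pochhammer_succ' (z t : R) (n : ℕ) :
    pochhammer z t (n + 1) = (1 - z) * pochhammer (z * t) t n := by
  simp only [pochhammer, prod_range_succ', pow_zero, mul_one]
  rw [mul_comm]
  congr 1
  exact prod_congr rfl fun m _ => by ring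

theorem pochhammer_mul_one_sub (z t : R) (n : ℕ) :
    pochhammer z t n * (1 - z * t ^ n) = (1 - z) * pochhammer (z * t) t n := by
  rw [← pochhammer_succ, pochhammer_succ']

set_option maxHeartbeats 4000000 in
/-- The first colour acts on both sides by the same operator `A e(z) + B e(z t)`. -/
theorem exists_head_eq (z t : R) (i₁ j₁ k₁ i₃ j₃ k₃ : Fin 2) (n q r : ℕ) :
    ∃ A B : R,
      (∀ s, s ≤ n → r ≤ q + s → leftHead z t i₁ j₁ k₁ i₃ j₃ k₃ n q s r =
        A * (z ^ s * pochhammer z t (n - s)) +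
          B * ((z * t) ^ s * pochhammer (z * t) t (n - s))) ∧
      (∀ s, s ≤ r → r ≤ q + s → r ≤ n + q → rightHead z t i₁ j₁ k₁ i₃ j₃ k₃ n q s r =
        A * (z ^ s * pochhammer z t (r - s)) +
          B * ((z * t) ^ s * pochhammer (z * t) t (r - s))) := by
  -- The first condition marks boundary bits for which both heads vanish. On the left, i₃ = 1
  -- contributes t^(q+s) in all, and j₂ = 1 cancels the t^s. But k₁ = 1, j₃ = 0 force j₂ = 0; the
  -- surviving t^s turns z^s into (zt)^s, whence B. If moreover i₁ = 0, splitting 1 = (1 - z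
  -- t^(n-s)) + z t^(n-s) gives the A term.
  obtain ⟨A, hA⟩ : ∃ A : R, A =
      if (i₁ : ℕ) + j₁ + k₁ ≠ i₃ + j₃ + k₃ ∨ k₁ < j₃ ∨ k₃ < j₁ then 0
      else if i₃ = 0 then t ^ (r + j₃ * q)
      else if i₁ = 1 ∧ k₁ = 1 ∧ j₃ = 0 then 0 else z * t ^ (n + q + j₃ * q) := ⟨_, rfl⟩
  obtain ⟨B, hB⟩ : ∃ B : R, B =
      if (i₁ : ℕ) + j₁ + k₁ ≠ i₃ + j₃ + k₃ ∨ k₁ < j₃ ∨ k₃ < j₁ then 0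
      else if i₃ = 1 ∧ k₁ = 1 ∧ j₃ = 0 then (1 - z) * t ^ q else 0 := ⟨_, rfl⟩
  refine ⟨A, B, fun s hs hr => ?_, fun s hs hr hq => ?_⟩
  · obtain ⟨d, rfl⟩ := Nat.exists_eq_add_of_le hs
    obtain ⟨e, he⟩ := Nat.exists_eq_add_of_le hr
    have h₁ : s + q - r = e := by omega
    have h₂ : 1 + (s + d) - s = d + 1 := by omega
    have h₃ : 1 + (s + d) - (1 + s) = d := by omega
    have h₄ : s + d - s = d := by omega
    have h₅ : t ^ r * t ^ e = t ^ q * t ^ s := by rw [← pow_add, ← pow_add, he]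
    have h₆ := pochhammer_mul_one_sub z t d
    simp only [leftHead, Fin.sum_univ_two, h₁, h₄]
    fin_cases i₁ <;> fin_cases j₁ <;> fin_cases k₁ <;> fin_cases i₃ <;> fin_cases j₃ <;>
      fin_cases k₃ <;> simp [AllowedBit, h₂, h₃] at hA hB ⊢ <;> subst hA hB <;>
      try simp only [pochhammer_succ]
    all_goals first
      | ring1
      | linear_combination z ^ s * pochhammer z t d * h₅ + t ^ q * t ^ s * z ^ s * h₆
      | linear_combination z ^ s * pochhammer z t d * (1 - z * t ^ d) * h₅ +
          t ^ q * t ^ s * z ^ s * h₆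
      | linear_combination z ^ (s + 1) * pochhammer z t d * t ^ d * h₅
      | linear_combination z ^ (s + 1) * pochhammer z t d * t ^ d * t ^ q * h₅
  · obtain ⟨d, rfl⟩ := Nat.exists_eq_add_of_le hs
    obtain ⟨e, rfl⟩ : ∃ e, q = d + e := Nat.exists_eq_add_of_le (by omega)
    have h₁ : s + (d + e) - (s + d) = e := by omega
    have h₂ : 1 + (s + d) - s = d + 1 := by omega
    have h₃ : 1 + (s + d) - (1 + s) = d := by omega
    have h₄ : s + d - s = d := by omega
    obtain ⟨m, hm⟩ := Nat.exists_eq_add_of_le hq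
    have h₅ : n + (d + e) - (s + d) = m := by omega
    have h₆ : t ^ s * t ^ m = t ^ n * t ^ e := by
      rw [← pow_add, ← pow_add, show s + m = n + e by omega]
    have h₇ := pochhammer_mul_one_sub z t d
    simp only [rightHead, Fin.sum_univ_two, h₁, h₄, h₅]
    clear hm h₅
    fin_cases i₁ <;> fin_cases j₁ <;> fin_cases k₁ <;> fin_cases i₃ <;> fin_cases j₃ <;>
      fin_cases k₃ <;> simp [AllowedBit, h₂, h₃] at hA hB ⊢ <;> subst hA hB <;>
      try simp only [pochhammer_succ]
    all_goals first
      | ring1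
      | linear_combination z ^ (s + 1) * pochhammer z t d * t ^ d * h₆ +
          t ^ (s + d + e) * z ^ s * h₇
      | linear_combination t ^ (s + d + e) * z ^ s * h₇
      | linear_combination z ^ (s + 1) * pochhammer z t d * t ^ d * h₆
      | linear_combination z ^ (s + 1) * pochhammer z t d * t ^ (d + d + e) * h₆

theorem leftSum_consLabel (z t : R) (i₁ j₁ k₁ i₃ j₃ k₃ : Fin 2) (I₁ J₁ K₁ I₃ J₃ K₃ : Label k) :
    t ^ weight I₃.nat * leftSum z t (consLabel i₁ I₁) (consLabel j₁ J₁) (consLabel k₁ K₁)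
      (consLabel i₃ I₃) (consLabel j₃ J₃) (consLabel k₃ K₃) =
    ∑ I₂ : Label k, ∑ J₂ : Label k, ∑ K₂ : Label k,
      if Allowed I₁ J₁ I₂ J₂ ∧ Allowed K₁ J₂ K₂ J₃ ∧ Allowed K₂ I₂ K₃ I₃ then
        t ^ (crossings J₁ I₂ J₂ + crossings J₂ K₂ J₃ + crossings I₂ K₃ I₃) *
          leftHead z t i₁ j₁ k₁ i₃ j₃ k₃ (weight I₁.nat) (weight K₁.nat - weight J₃.nat)
            (weight J₂.nat) (weight I₃.nat)
      else 0 := by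
  rw [leftSum, sum_consLabel₃]
  simp only [mul_sum]
  refine sum_congr rfl fun I₂ _ => sum_congr rfl fun J₂ _ => sum_congr rfl fun K₂ _ => ?_
  simp only [allowed_consLabel, crossings_consLabel, weight_consLabel]
  by_cases h : Allowed I₁ J₁ I₂ J₂ ∧ Allowed K₁ J₂ K₂ J₃ ∧ Allowed K₂ I₂ K₃ I₃
  · obtain ⟨h₁, h₂, h₃⟩ := id h
    have e₁ : weight (fun i => I₂.nat i - J₁.nat i) = weight I₁.nat - weight J₂.nat := by
      have := h₁.weight_add; have := h₁.weight_sub; omega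
    have e₂ : weight (fun i => K₂.nat i - J₂.nat i) = weight K₁.nat - weight J₃.nat := by
      have := h₂.weight_add; have := h₂.weight_sub; omega
    have e₃ : weight (fun i => K₃.nat i - I₂.nat i) =
        weight J₂.nat + (weight K₁.nat - weight J₃.nat) - weight I₃.nat := by
      have := h₂.weight_add; have := h₂.weight_sub
      have := h₃.weight_add; have := h₃.weight_sub; omega
    rw [if_pos h, leftHead]
    simp only [mul_sum, e₁, e₂, e₃, h₁, h₂, h₃, and_true]
    refine sum_congr rfl fun a _ => sum_congr rfl fun b _ => sum_congr rfl fun c _ => ?_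
    split_ifs
    · ring
    · simp
  · rw [if_neg h]
    refine sum_eq_zero fun a _ => sum_eq_zero fun b _ => sum_eq_zero fun c _ => ?_
    rw [if_neg (by tauto), mul_zero]

theorem rightSum_consLabel (z t : R) (i₁ j₁ k₁ i₃ j₃ k₃ : Fin 2) (I₁ J₁ K₁ I₃ J₃ K₃ : Label k) :
    t ^ weight I₃.nat * rightSum z t (consLabel i₁ I₁) (consLabel j₁ J₁) (consLabel k₁ K₁)
      (consLabel i₃ I₃) (consLabel j₃ J₃) (consLabel k₃ K₃) =
    ∑ I₂ : Label k, ∑ J₂ : Label k, ∑ K₂ : Label k,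
      if Allowed K₁ I₁ K₂ I₂ ∧ Allowed K₂ J₁ K₃ J₂ ∧ Allowed I₂ J₂ I₃ J₃ then
        t ^ (crossings I₁ K₂ I₂ + crossings J₁ K₃ J₂ + crossings J₂ I₃ J₃) *
          rightHead z t i₁ j₁ k₁ i₃ j₃ k₃ (weight I₁.nat) (weight K₁.nat - weight J₃.nat)
            (weight J₂.nat) (weight I₃.nat)
      else 0 := by
  rw [rightSum, sum_consLabel₃]
  simp only [mul_sum]
  refine sum_congr rfl fun I₂ _ => sum_congr rfl fun J₂ _ => sum_congr rfl fun K₂ _ => ?_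
  simp only [allowed_consLabel, crossings_consLabel, weight_consLabel]
  by_cases h : Allowed K₁ I₁ K₂ I₂ ∧ Allowed K₂ J₁ K₃ J₂ ∧ Allowed I₂ J₂ I₃ J₃
  · obtain ⟨h₁, h₂, h₃⟩ := id h
    have := h₁.weight_add
    have := h₁.weight_sub
    have := h₂.weight_add
    have := h₂.weight_sub
    have := h₃.weight_add
    have := h₃.weight_sub
    have e₁ : weight (fun i => K₂.nat i - I₁.nat i) =
        weight J₂.nat + (weight K₁.nat - weight J₃.nat) - weight I₃.nat := by omega
    have e₂ : weight (fun i => K₃.nat i - J₁.nat i) =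
        weight I₁.nat + (weight K₁.nat - weight J₃.nat) - weight I₃.nat := by omega
    have e₃ : weight (fun i => I₃.nat i - J₂.nat i) = weight I₃.nat - weight J₂.nat := by omega
    rw [if_pos h, rightHead]
    simp only [mul_sum, e₁, e₂, e₃, h₁, h₂, h₃, and_true]
    refine sum_congr rfl fun a _ => sum_congr rfl fun b _ => sum_congr rfl fun c _ => ?_
    split_ifs
    · ring
    · simp
  · rw [if_neg h]
    refine sum_eq_zero fun a _ => sum_eq_zero fun b _ => sum_eq_zero fun c _ => ?_
    rw [if_neg (by tauto), mul_zero]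

end Sums

/-! ### Induction on the number of colours -/

theorem leftSum_eq_rightSum_of_ne_zero {R : Type*} [CommRing R] [IsDomain R] {t : R} (ht : t ≠ 0)
    {k : ℕ} (z : R) (I₁ J₁ K₁ I₃ J₃ K₃ : Label k) :
    leftSum z t I₁ J₁ K₁ I₃ J₃ K₃ = rightSum z t I₁ J₁ K₁ I₃ J₃ K₃ := by
  induction k generalizing z with
  | zero => simp [leftSum, rightSum, Allowed, crossings, phi, weight, pochhammer]
  | succ k ih =>
    obtain ⟨i₁, I₁, rfl⟩ := exists_consLabel I₁
    obtain ⟨j₁, J₁, rfl⟩ := exists_consLabel J₁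
    obtain ⟨k₁, K₁, rfl⟩ := exists_consLabel K₁
    obtain ⟨i₃, I₃, rfl⟩ := exists_consLabel I₃
    obtain ⟨j₃, J₃, rfl⟩ := exists_consLabel J₃
    obtain ⟨k₃, K₃, rfl⟩ := exists_consLabel K₃
    obtain ⟨A, B, hl, hr⟩ := exists_head_eq z t i₁ j₁ k₁ i₃ j₃ k₃ (weight I₁.nat)
      (weight K₁.nat - weight J₃.nat) (weight I₃.nat)
    -- Without the factor t^|I₃|, the coefficient B would involve t^(q-r), whose exponent may be
    -- negative.
    refine mul_left_cancel₀ (pow_ne_zero (weight I₃.nat) ht) ?_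
    trans A * leftSum z t I₁ J₁ K₁ I₃ J₃ K₃ + B * leftSum (z * t) t I₁ J₁ K₁ I₃ J₃ K₃
    · rw [leftSum_consLabel, leftSum, leftSum]
      simp only [mul_sum, ← sum_add_distrib]
      refine sum_congr rfl fun I₂ _ => sum_congr rfl fun J₂ _ => sum_congr rfl fun K₂ _ => ?_
      split_ifs with h
      · have := h.1.weight_add
        have := h.1.weight_sub
        have := h.2.1.weight_add
        have := h.2.1.weight_sub
        have := h.2.2.weight_add
        have := h.2.2.weight_sub
        rw [hl _ (by omega) (by omega)]
        ring
      · simp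
    · rw [ih, ih, rightSum_consLabel, rightSum, rightSum]
      simp only [mul_sum, ← sum_add_distrib]
      refine sum_congr rfl fun I₂ _ => sum_congr rfl fun J₂ _ => sum_congr rfl fun K₂ _ => ?_
      split_ifs with h
      · have := h.1.weight_add
        have := h.1.weight_sub
        have := h.2.1.weight_add
        have := h.2.1.weight_sub
        have := h.2.2.weight_add
        have := h.2.2.weight_sub
        rw [hr _ (by omega) (by omega) (by omega)]
        ring
      · simp

theorem map_pochhammer {R S : Type*} [CommRing R] [CommRing S] (f : R →+* S) (z t : R) (n : ℕ) :
    f (pochhammer z t n) = pochhammer (f z) (f t) n := by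
  simp [pochhammer]

theorem map_leftSum {R S : Type*} [CommRing R] [CommRing S] (f : R →+* S) {k : ℕ} (z t : R)
    (I₁ J₁ K₁ I₃ J₃ K₃ : Label k) :
    f (leftSum z t I₁ J₁ K₁ I₃ J₃ K₃) = leftSum (f z) (f t) I₁ J₁ K₁ I₃ J₃ K₃ := by
  simp [leftSum, apply_ite f, map_pochhammer]

theorem map_rightSum {R S : Type*} [CommRing R] [CommRing S] (f : R →+* S) {k : ℕ} (z t : R)
    (I₁ J₁ K₁ I₃ J₃ K₃ : Label k) :
    f (rightSum z t I₁ J₁ K₁ I₃ J₃ K₃) = rightSum (f z) (f t) I₁ J₁ K₁ I₃ J₃ K₃ := by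
  simp [rightSum, apply_ite f, map_pochhammer]

/-- Both sums are polynomial in t, so the identity for an indeterminate t specialises to every t,
including 0. -/
theorem leftSum_eq_rightSum {F : Type*} [Field F] {k : ℕ} (z t : F)
    (I₁ J₁ K₁ I₃ J₃ K₃ : Label k) :
    leftSum z t I₁ J₁ K₁ I₃ J₃ K₃ = rightSum z t I₁ J₁ K₁ I₃ J₃ K₃ := by
  have h := congrArg (Polynomial.evalRingHom t) (leftSum_eq_rightSum_of_ne_zero
    (Polynomial.X_ne_zero (R := F)) (Polynomial.C z) I₁ J₁ K₁ I₃ J₃ K₃)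
  simpa [map_leftSum, map_rightSum] using h

theorem yang_baxter {F : Type*} [Field F] {k : ℕ} (x y t : F) (hy : y ≠ 0)
    (I₁ J₁ K₁ I₃ J₃ K₃ : Label k) :
    (∑ I₂ : Label k, ∑ J₂ : Label k, ∑ K₂ : Label k,
      crossR (x / y) t I₁ J₁ I₂ J₂ * purpleL x t K₁ J₂ K₂ J₃ * purpleL y t K₂ I₂ K₃ I₃) =
    ∑ I₂ : Label k, ∑ J₂ : Label k, ∑ K₂ : Label k,
      purpleL y t K₁ I₁ K₂ I₂ * purpleL x t K₂ J₁ K₃ J₂ * crossR (x / y) t I₂ J₂ I₃ J₃ := by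
  obtain ⟨z, rfl⟩ : ∃ z, x = z * y := ⟨x / y, (div_mul_cancel₀ x hy).symm⟩
  rw [mul_div_cancel_right₀ z hy]
  trans y ^ (weight I₃.nat + weight J₃.nat) * z ^ weight J₃.nat * leftSum z t I₁ J₁ K₁ I₃ J₃ K₃
  · simp only [leftSum, mul_sum]
    refine sum_congr rfl fun I₂ _ => sum_congr rfl fun J₂ _ => sum_congr rfl fun K₂ _ => ?_
    by_cases h₁ : Allowed I₁ J₁ I₂ J₂ <;> by_cases h₂ : Allowed K₁ J₂ K₂ J₃ <;>
      by_cases h₃ : Allowed K₂ I₂ K₃ I₃ <;> simp [crossR, purpleL, h₁, h₂, h₃]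
    have e : weight I₂.nat - weight J₁.nat = weight I₁.nat - weight J₂.nat := by
      have := h₁.weight_add; omega
    rw [e]
    simp only [crossings]
    ring
  · rw [leftSum_eq_rightSum]
    simp only [rightSum, mul_sum]
    refine sum_congr rfl fun I₂ _ => sum_congr rfl fun J₂ _ => sum_congr rfl fun K₂ _ => ?_
    by_cases h₁ : Allowed K₁ I₁ K₂ I₂ <;> by_cases h₂ : Allowed K₂ J₁ K₃ J₂ <;>
      by_cases h₃ : Allowed I₂ J₂ I₃ J₃ <;> simp [crossR, purpleL, h₁, h₂, h₃]
    rw [← h₃.weight_add]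
    simp only [crossings]
    ring

/-! ### Transfer matrices and the row swap -/

section Rows
variable {R : Type*} [CommRing R] {k : ℕ}

theorem sum_fin_succ {M α : Type*} [AddCommMonoid M] [Fintype α] {N : ℕ}
    (f : (Fin (N + 1) → α) → M) : ∑ h, f h = ∑ a, ∑ h, f (Fin.cons a h) := by
  rw [← Fintype.sum_prod_type', ← (Fin.consEquiv (fun _ => α)).sum_comp]
  rfl

theorem purpleRow_zero (x t : R) (left right : Label k) (bottom top : Fin 0 → Label k) :
    purpleRow x t left right bottom top = if left = right then 1 else 0 := by
  simp only [purpleRow, sum_fin_succ, Fin.prod_univ_zero]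
  by_cases h : left = right
  · subst h
    simp [Finset.sum_ite_eq']
  · rw [if_neg h]
    refine sum_eq_zero fun a _ => sum_eq_zero fun g _ => if_neg ?_
    rintro ⟨rfl, h'⟩
    exact h h'

theorem purpleRow_succ {N : ℕ} (x t : R) (left right : Label k)
    (bottom top : Fin (N + 1) → Label k) :
    purpleRow x t left right bottom top =
      ∑ a, purpleL x t (bottom 0) left (top 0) a *
        purpleRow x t a right (Fin.tail bottom) (Fin.tail top) := by
  have last_cons (a : Label k) (h : Fin (N + 1) → Label k) :
      (Fin.cons a h : Fin (N + 2) → Label k) (Fin.last (N + 1)) = h (Fin.last N) := by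
    rw [← Fin.succ_last, Fin.cons_succ]
  rw [purpleRow, sum_fin_succ, sum_eq_single left]
  · simp only [purpleRow, mul_sum]
    rw [sum_comm]
    refine sum_congr rfl fun h _ => ?_
    rw [sum_eq_single (h 0)]
    · simp only [Fin.cons_zero, last_cons, true_and, Fin.prod_univ_succ, Fin.castSucc_zero,
        Fin.cons_succ, ← Fin.succ_castSucc, Fin.tail, mul_ite, mul_zero]
    · intro a _ ha
      rw [if_neg (fun h' => ha h'.1.symm), mul_zero]
    · simp
  · intro a _ ha
    exact sum_eq_zero fun h _ => if_neg fun h' => ha h'.1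
  · simp

/-- The transfer matrix of two stacked boxes; states are pairs `(lower label, upper label)`. -/
def columnMatrix (x₁ x₂ t : R) (b c : Label k) : Matrix (Label k × Label k) (Label k × Label k) R :=
  fun p q => ∑ m, purpleL x₁ t b p.1 m q.1 * purpleL x₂ t m p.2 c q.2

/-- The transfer matrix of two stacked rows. -/
def rowsMatrix {N : ℕ} (x₁ x₂ t : R) (bottom top : Fin N → Label k) :
    Matrix (Label k × Label k) (Label k × Label k) R :=
  fun p q => ∑ mid : Fin N → Label k,
    purpleRow x₁ t p.1 q.1 bottom mid * purpleRow x₂ t p.2 q.2 mid top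

/-- The transfer matrix of a cross. -/
def crossMatrix (k : ℕ) (z t : R) : Matrix (Label k × Label k) (Label k × Label k) R :=
  -- States are (lower, upper), while `crossR` takes the top right edge before the bottom right one.
  fun p q => crossR z t p.1 p.2 q.2 q.1

theorem rowsMatrix_zero (x₁ x₂ t : R) (bottom top : Fin 0 → Label k) :
    rowsMatrix x₁ x₂ t bottom top = 1 := by
  ext p q
  by_cases h₁ : p.1 = q.1 <;> by_cases h₂ : p.2 = q.2 <;>
    simp [rowsMatrix, purpleRow_zero, Matrix.one_apply, Prod.ext_iff, h₁, h₂]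

theorem rowsMatrix_succ {N : ℕ} (x₁ x₂ t : R) (bottom top : Fin (N + 1) → Label k) :
    rowsMatrix x₁ x₂ t bottom top = columnMatrix x₁ x₂ t (bottom 0) (top 0) *
      rowsMatrix x₁ x₂ t (Fin.tail bottom) (Fin.tail top) := by
  ext p q
  simp only [rowsMatrix, columnMatrix, Matrix.mul_apply, sum_fin_succ, purpleRow_succ,
    Fin.cons_zero, Fin.tail_cons, Fintype.sum_prod_type]
  simp only [sum_mul_sum]
  calc _ = ∑ m, ∑ a, ∑ mid, ∑ b, _ := sum_congr rfl fun m _ => sum_comm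
    _ = ∑ m, ∑ a, ∑ b, ∑ mid, _ :=
      sum_congr rfl fun m _ => sum_congr rfl fun a _ => sum_comm
    _ = ∑ a, ∑ m, ∑ b, ∑ mid, _ := sum_comm
    _ = ∑ a, ∑ b, ∑ m, ∑ mid, _ := sum_congr rfl fun a _ => sum_comm
    _ = _ := by
      refine sum_congr rfl fun a _ => sum_congr rfl fun b _ => sum_congr rfl fun m _ =>
        sum_congr rfl fun mid _ => ?_
      ring

end Rows

section Swap
variable {F : Type*} [Field F] {k : ℕ} (x y t : F)

theorem crossMatrix_mul_columnMatrix (hy : y ≠ 0) (b c : Label k) :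
    crossMatrix k (x / y) t * columnMatrix x y t b c =
      columnMatrix y x t b c * crossMatrix k (x / y) t := by
  ext ⟨I₁, J₁⟩ ⟨J₃, I₃⟩
  simp only [Matrix.mul_apply, crossMatrix, columnMatrix, Fintype.sum_prod_type, mul_sum, sum_mul]
  -- To the right of the cross the lower strand carries J₂, so the state there is (J₂, I₂) and the
  -- two sums are exchanged.
  rw [sum_comm, ← yang_baxter x y t hy I₁ J₁ b I₃ J₃ c]
  simp only [mul_assoc]

theorem crossMatrix_mul_rowsMatrix (hy : y ≠ 0) {N : ℕ} (bottom top : Fin N → Label k) :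
    crossMatrix k (x / y) t * rowsMatrix x y t bottom top =
      rowsMatrix y x t bottom top * crossMatrix k (x / y) t := by
  induction N with
  | zero => simp [rowsMatrix_zero]
  | succ N ih =>
    rw [rowsMatrix_succ, rowsMatrix_succ, ← mul_assoc, crossMatrix_mul_columnMatrix x y t hy,
      mul_assoc, ih, mul_assoc]

end Swap

section Boundary
variable {R : Type*} [CommRing R] {k : ℕ}

theorem allowed_zero_left {K L : Label k} :
    Allowed (fun _ => 0) (fun _ => 0) K L ↔ K = (fun _ => 0) ∧ L = fun _ => 0 := by
  simp only [Allowed, Label.nat, funext_iff, Fin.ext_iff, ← forall_and]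
  refine forall_congr' fun i => ?_
  simp only [Fin.val_zero]
  omega

theorem allowed_zero_right {I J : Label k} :
    Allowed I J (fun _ => 0) (fun _ => 0) ↔ I = (fun _ => 0) ∧ J = fun _ => 0 := by
  simp only [Allowed, Label.nat, funext_iff, Fin.ext_iff, ← forall_and]
  refine forall_congr' fun i => ?_
  simp only [Fin.val_zero]
  omega

theorem crossR_zero (z t : R) :
    crossR z t (fun _ => 0 : Label k) (fun _ => 0) (fun _ => 0) (fun _ => 0) = 1 := by
  rw [crossR, if_pos (allowed_zero_left.2 ⟨rfl, rfl⟩)]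
  simp [weight, phi, Label.nat, pochhammer]

/-- Conservation: if no path enters the cross, none leaves it, and the empty cross has weight 1. -/
theorem crossMatrix_zero_left (z t : R) (q : Label k × Label k) :
    crossMatrix k z t (fun _ => 0, fun _ => 0) q =
      if q = (fun _ => 0, fun _ => 0) then 1 else 0 := by
  split_ifs with h
  · rw [h, crossMatrix, crossR_zero]
  · exact if_neg fun h' => h (Prod.ext_iff.2 (allowed_zero_left.1 h').symm)

theorem crossMatrix_zero_right (z t : R) (p : Label k × Label k) :
    crossMatrix k z t p (fun _ => 0, fun _ => 0) =
      if p = (fun _ => 0, fun _ => 0) then 1 else 0 := by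
  split_ifs with h
  · rw [h, crossMatrix, crossR_zero]
  · exact if_neg fun h' => h (Prod.ext_iff.2 (allowed_zero_right.1 h'))

end Boundary

theorem twoPurpleRows_comm {F : Type*} [Field F] {k N : ℕ} (x y t : F) (hy : y ≠ 0)
    (bottom top : Fin N → Label k) :
    twoPurpleRows x y t bottom top = twoPurpleRows y x t bottom top := by
  -- In the (0, 0) entry the cross contributes a unit row on one side and a unit column on the
  -- other.
  have h := congrFun₂ (crossMatrix_mul_rowsMatrix x y t hy bottom top)
    (fun _ => 0, fun _ => 0) (fun _ => 0, fun _ => 0)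
  simp only [Matrix.mul_apply, crossMatrix_zero_left, crossMatrix_zero_right, ite_mul, one_mul,
    zero_mul, mul_ite, mul_one, mul_zero, sum_ite_eq', mem_univ, if_true] at h
  exact h

end PurpleVertex

theorem mainTheorem5 {F : Type*} [Field F] (x y t : F) (hy : y ≠ 0) (k : ℕ) :
    -- The Yang-Baxter equation, for every boundary condition.
    (∀ I₁ J₁ K₁ I₃ J₃ K₃ : PurpleVertex.Label k,
      (∑ I₂ : PurpleVertex.Label k, ∑ J₂ : PurpleVertex.Label k, ∑ K₂ : PurpleVertex.Label k,
        PurpleVertex.crossR (x / y) t I₁ J₁ I₂ J₂ *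
          PurpleVertex.purpleL x t K₁ J₂ K₂ J₃ *
          PurpleVertex.purpleL y t K₂ I₂ K₃ I₃) =
      ∑ I₂ : PurpleVertex.Label k, ∑ J₂ : PurpleVertex.Label k, ∑ K₂ : PurpleVertex.Label k,
        PurpleVertex.purpleL y t K₁ I₁ K₂ I₂ *
          PurpleVertex.purpleL x t K₂ J₁ K₃ J₂ *
          PurpleVertex.crossR (x / y) t I₂ J₂ I₃ J₃) ∧
    -- Two adjacent purple rows may be swapped.
    (∀ (N : ℕ) (bottom top : Fin N → PurpleVertex.Label k),
      PurpleVertex.twoPurpleRows x y t bottom top =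
        PurpleVertex.twoPurpleRows y x t bottom top) := by
  exact ⟨PurpleVertex.yang_baxter x y t hy, fun _ => PurpleVertex.twoPurpleRows_comm x y t hy⟩
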